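/- An \emph{mm-space} is a triple $(X,d,\mu)$ where $(X,d)$ is a separable metric space whose Borel $\sigma$-algebra is standard and $\mu$ is a Borel probability measure. A \emph{parametrization} of $X$ is a measurable map $\phi:[0,1]\to X$ with $\phi_*\lambda=\mu$, where $\lambda$ is Lebesgue measure. For measurable $f,g:[0,1]\to\mathbb R$ put $\mathrm{me}_1(f,g)=\inf\{\varepsilon>0:\lambda\{|f-g|>\varepsilon\}<\varepsilon\}$. The Gromov distance $d_{conc}(X,Y)$ is the infimum of all $\varepsilon>0$ for which there are parametrizations $\phi_X,\phi_Y$ such that for every $1$-Lipschitz $f:X\to\mathbb R$ there is a $1$-Lipschitz $g:Y\to\mathbb R$ with $\mathrm{me}_1(f\circ\phi_X,g\circ\phi_Y)<\varepsilon$, and conversely for every such $g$ there is such an $f$. A sequence $(X_n)$ of mm-spaces is a \emph{L\'evy family} if for every $\varepsilon>0$ the concentration functions $\alpha_{X_n}(\varepsilon)=1-\inf\{\mu_n(A_\varepsilon): A\subseteq X_n \text{ Borel},\ \mu_n(A)\ge \tfrac12\}$ tend to $0$, where $A_\varepsilon$ is the open $\varepsilon$-neighbourhood of $A$. Let $\mathscr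 M$ be a class of mm-spaces. A function $\partial:\mathscr M\to[0,\infty]$ is an \emph{intrinsic dimension function} if (1) a sequence $(X_n)$ in $\mathscr M$ is a L\'evy family if and only if $\partial(X_n)\to\infty$; (2) if $X_n,X\in\mathscr M$ and $d_{conc}(X_n,X)\to0$, then $\partial(X_n)\to\partial(X)$; (3) for some sequence $(X_n)$ in $\mathscr M$ with $d_{conc}(X_n,\mathbb S^n)\to0$ one has $\partial(X_n)=\Theta(n)$, where $\mathbb S^n\subset\mathbb R^{n+1}$ is the unit sphere with the Euclidean distance and the rotation-invariant probability measure. \textbf{Corollary.} Let $\partial:\mathscr M\to[0,\infty]$ be an intrinsic dimension function and let $\Omega=(\Omega,d,\mu)\in\mathscr M$ be non-atomic. Then $\partial(\Omega)<\infty$, and for every $\varepsilon>0$ and $\delta>0$ there is $n_0=n_0(\partial,\Omega,\varepsilon,\delta)$ such that for every $n\ge n_0$, $n\geq 1$, the following holds with probability $>1-\delta$ for an i.i.d. sample $x_1,\dots,x_n$ drawn from $\mu$: if the set $X=\{x_1,\dots,x_n\}$, with the restriction of $d$ and the normalized counting measure, belongs to $\mathscr M$ (that is, if $\partial(X)$ is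 defined), then $\partial(X)<\infty$ and \[ |\partial(\Omega)-\partial(X)|<\varepsilon . \] -/

import Mathlib

open MeasureTheory Filter Topology
open scoped ENNReal

universe u v

noncomputable section

/-- A space with metric and measure: a metric space with a probability measure on its Borel
sets. As usual the underlying Borel space is standard and the metric is separable, which is what
guarantees that the space is parametrized by the unit interval. -/
structure MMSpace : Type (u + 1) where
  carrier : Type u
  [metric : MetricSpace carrier]
  [measurable : MeasurableSpace carrier]
  [borel : BorelSpace carrier]
  [separable : TopologicalSpace.SeparableSpace carrier]
  [standard : StandardBorelSpace carrier]
  μ : Measure carrier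
  [prob : IsProbabilityMeasure μ]

namespace MMSpace

instance : CoeSort MMSpace.{u} (Type u) := ⟨carrier⟩

attribute [instance] metric measurable borel separable standard prob

/-- A parametrization of `X` by the unit interval with Lebesgue measure. -/
def IsParam (X : MMSpace.{u}) (φ : unitInterval → X) : Prop :=
  MeasurePreserving φ volume X.μ

/-- The metric `me₁` of convergence in measure for functions on the unit interval. -/
def me1 (f g : unitInterval → ℝ) : ℝ :=
  sInf {ε : ℝ | 0 < ε ∧
    (volume : Measure unitInterval).real {t | ε < |f t - g t|} < ε}

/-- Gromov's distance between two mm-spaces. -/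
def dconc (X : MMSpace.{u}) (Y : MMSpace.{v}) : ℝ :=
  sInf {ε : ℝ | 0 < ε ∧ ∃ (φ : unitInterval → X) (ψ : unitInterval → Y),
    X.IsParam φ ∧ Y.IsParam ψ ∧
    (∀ f : X → ℝ, LipschitzWith 1 f →
      ∃ g : Y → ℝ, LipschitzWith 1 g ∧ me1 (f ∘ φ) (g ∘ ψ) < ε) ∧
    (∀ g : Y → ℝ, LipschitzWith 1 g →
      ∃ f : X → ℝ, LipschitzWith 1 f ∧ me1 (f ∘ φ) (g ∘ ψ) < ε)}

/-- The concentration function `α_X(ε)`, for `ε > 0` (the value at `0` is `1/2`). -/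
def concFun (X : MMSpace.{u}) (ε : ℝ) : ℝ :=
  if ε = 0 then 1 / 2 else
    1 - sInf {r : ℝ | ∃ A : Set X, MeasurableSet A ∧ 1 / 2 ≤ X.μ.real A ∧
      r = X.μ.real (Metric.thickening ε A)}

/-- Lévy families: the concentration functions tend to zero pointwise. -/
def IsLevy (X : ℕ → MMSpace.{u}) : Prop :=
  ∀ ε : ℝ, 0 < ε → Tendsto (fun n => (X n).concFun ε) atTop (𝓝 0)

lemma toSphere_univ_ne_zero (n : ℕ) :
    (volume : Measure (EuclideanSpace ℝ (Fin (n + 1)))).toSphere Set.univ ≠ 0 := by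
  rw [Measure.toSphere_apply_univ]
  simp [finrank_euclideanSpace, (Metric.measure_ball_pos volume _ one_pos).ne']

/-- The unit sphere `𝕊ⁿ` of `ℝⁿ⁺¹`, with the Euclidean distance and the normalized
surface measure. -/
def unitSphere (n : ℕ) : MMSpace.{0} :=
  haveI : IsProbabilityMeasure (ProbabilityTheory.cond
      (volume : Measure (EuclideanSpace ℝ (Fin (n + 1)))).toSphere Set.univ) :=
    ProbabilityTheory.cond_isProbabilityMeasure (toSphere_univ_ne_zero n)
  { carrier := Metric.sphere (0 : EuclideanSpace ℝ (Fin (n + 1))) 1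
    μ := ProbabilityTheory.cond
      (volume : Measure (EuclideanSpace ℝ (Fin (n + 1)))).toSphere Set.univ }

/-- The mm-space on the set of points of a (nonempty) finite sample of `Ω`, with the restriction
of the distance of `Ω` and the normalized counting measure. -/
def sample (Ω : MMSpace.{u}) {n : ℕ} [NeZero n] (x : Fin n → Ω) : MMSpace.{u} :=
  haveI : Nonempty (Set.range x) := ⟨⟨x 0, 0, rfl⟩⟩
  haveI : IsProbabilityMeasure (ProbabilityTheory.uniformOn (Set.univ : Set (Set.range x))) :=
    ProbabilityTheory.isProbabilityMeasure_uniformOn Set.finite_univ Set.univ_nonempty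
  { carrier := Set.range x
    μ := ProbabilityTheory.uniformOn (Set.univ : Set (Set.range x)) }

/-- Intrinsic dimension functions on a class `𝓜` of mm-spaces. -/
structure IsIntrinsicDim (𝓜 : Set MMSpace.{u}) (dim : 𝓜 → ℝ≥0∞) : Prop where
  /-- Axiom of concentration. -/
  concentration : ∀ X : ℕ → 𝓜,
    IsLevy (fun n => (X n : MMSpace.{u})) ↔ Tendsto (fun n => dim (X n)) atTop (𝓝 ∞)
  /-- Axiom of smooth dependence on datasets. -/
  smooth : ∀ (X : ℕ → 𝓜) (Y : 𝓜),
    Tendsto (fun n => dconc (X n : MMSpace.{u}) (Y : MMSpace.{u})) atTop (𝓝 0) →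
      Tendsto (fun n => dim (X n)) atTop (𝓝 (dim Y))
  /-- Axiom of normalization: `dim (X n) = Θ(n)` for some family approaching the spheres. -/
  normalization : ∃ X : ℕ → 𝓜,
    Tendsto (fun n => dconc (X n : MMSpace.{u}) (unitSphere n)) atTop (𝓝 0) ∧
      ∃ c C : ℝ, 0 < c ∧ c < C ∧ ∃ N : ℕ, ∀ n ≥ N,
        ENNReal.ofReal c * dim (X n) ≤ n ∧ n ≤ ENNReal.ofReal C * dim (X n)

end MMSpace

end

/-! Finiteness: if `dim Ω = ∞`, the concentration axiom makes the constant sequence `Ω` a Lévy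
family, which is impossible without atoms (`not_isLevy_const`). Approximation: the smoothness axiom
is sequential continuity for `dconc`, so it suffices that large samples are `dconc`-close to `Ω`
with high probability (`exists_dconc_sample_le`). Cut `Ω` into finitely many cells, small in
diameter except for one small in measure. By Chebyshev, all cell frequencies of a large sample are
close to the true masses. The sample measure and `Ω.μ` then have a coupling whose two points lie in
the same cell up to small probability (`exists_coupling_label_ne_le`). Parametrizing this coupling
by the unit interval gives two parametrizations that are close in measure, and this bounds `dconc`
for all 1-Lipschitz functions at once. Non-atomicity enters again here: sample points are a.s.
distinct, so the uniform measure on the sample set is the empirical measure. -/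

/-! ### Couplings of measures with finite labellings. -/

section Coupling

open ProbabilityTheory

variable {α β ι : Type*} [MeasurableSpace α] [MeasurableSpace β] [Fintype ι]

/-- The measure on `α × β` built from two finite partitions `A`, `B` that puts mass
`min (μ (A i)) (ν (B i))` on `A i ×ˢ B i` and spreads the excess masses as a product. -/
noncomputable def partitionCoupling (μ : Measure α) (ν : Measure β) (A : ι → Set α)
    (B : ι → Set β) : Measure (α × β) :=
  ∑ i, min (μ (A i)) (ν (B i)) • (cond μ (A i)).prod (cond ν (B i)) +
    (∑ i, (μ (A i) - ν (B i)))⁻¹ •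
      (∑ i, (μ (A i) - ν (B i)) • cond μ (A i)).prod (∑ i, (ν (B i) - μ (A i)) • cond ν (B i))

/-- Conditioning on a null set gives the zero measure, but then the bound forces `c = 0`; cells of
measure zero thus need no separate treatment. -/
lemma mul_cond_univ_of_le (ν : Measure β) [IsFiniteMeasure ν] (B : Set β) {c : ℝ≥0∞}
    (hc : c ≤ ν B) : c * cond ν B Set.univ = c := by
  by_cases h : ν B = 0
  · simp [le_zero_iff.1 (hc.trans h.le)]
  · have := cond_isProbabilityMeasure (μ := ν) h
    simp

lemma sum_measure_smul_cond (μ : Measure α) [IsFiniteMeasure μ] {ℓ : α → ι}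
    (hℓ : ∀ i, MeasurableSet (ℓ ⁻¹' {i})) (S : Set α) (hS : MeasurableSet S) :
    ∑ i, μ (ℓ ⁻¹' {i}) * cond μ (ℓ ⁻¹' {i}) S = μ S := by
  have h : ∀ i, μ (ℓ ⁻¹' {i}) * cond μ (ℓ ⁻¹' {i}) S = μ (ℓ ⁻¹' {i} ∩ S) := fun i => by
    rw [mul_comm, cond_mul_eq_inter (hℓ i)]
  simp_rw [h]
  rw [← measure_biUnion_finset (s := Finset.univ)]
  · congr 1; ext x; simp
  · intro i _ j _ hij
    refine Set.disjoint_left.2 fun x hx hx' => hij ?_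
    rw [← hx.1, ← hx'.1]
  · exact fun i _ => (hℓ i).inter hS

lemma sum_measure_fiber (μ : Measure α) [IsProbabilityMeasure μ] {ℓ : α → ι}
    (hℓ : ∀ i, MeasurableSet (ℓ ⁻¹' {i})) : ∑ i, μ (ℓ ⁻¹' {i}) = 1 := by
  have h := sum_measure_smul_cond μ hℓ Set.univ .univ
  simpa [mul_cond_univ_of_le] using h

lemma ENNReal.min_add_tsub_right (a b : ℝ≥0∞) : min a b + (a - b) = a := by
  rcases le_total a b with h | h
  · rw [min_eq_left h, tsub_eq_zero_of_le h, add_zero]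
  · rw [min_eq_right h, add_tsub_cancel_of_le h]

instance sFinite_finsetSum_smul (c : ι → ℝ≥0∞) (m : ι → Measure α) [∀ i, SFinite (m i)] :
    SFinite (∑ i, c i • m i) := by
  rw [← Measure.sum_fintype]
  infer_instance

/-- Each side, added to the finite sum of the minima, gives the common total. -/
lemma ENNReal.sum_tsub_comm_of_sum_eq (p q : ι → ℝ≥0∞) (hp : ∑ i, p i ≠ ∞)
    (h : ∑ i, p i = ∑ i, q i) : ∑ i, (p i - q i) = ∑ i, (q i - p i) := by
  have hm : ∑ i, min (p i) (q i) ≠ ∞ :=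
    ne_top_of_le_ne_top hp (Finset.sum_le_sum fun i _ => min_le_left _ _)
  refine (ENNReal.add_right_inj hm).1 ?_
  rw [← Finset.sum_add_distrib, ← Finset.sum_add_distrib]
  simp_rw [ENNReal.min_add_tsub_right]
  rw [h]
  refine Finset.sum_congr rfl fun i _ => ?_
  rw [min_comm, ENNReal.min_add_tsub_right]

variable (μ : Measure α) (ν : Measure β) [IsProbabilityMeasure μ] [IsProbabilityMeasure ν]
  {ℓ : α → ι} {ℓ' : β → ι}

lemma partitionCoupling_map_fst
    (hℓ : ∀ i, MeasurableSet (ℓ ⁻¹' {i})) (hℓ' : ∀ i, MeasurableSet (ℓ' ⁻¹' {i})) :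
    (partitionCoupling μ ν (fun i => ℓ ⁻¹' {i}) (fun i => ℓ' ⁻¹' {i})).map Prod.fst = μ := by
  ext S hS
  have hr := ENNReal.sum_tsub_comm_of_sum_eq (fun i => μ (ℓ ⁻¹' {i})) (fun i => ν (ℓ' ⁻¹' {i}))
    (by simp [sum_measure_fiber μ hℓ]) (by rw [sum_measure_fiber μ hℓ, sum_measure_fiber ν hℓ'])
  have hfin : ∑ i, (μ (ℓ ⁻¹' {i}) - ν (ℓ' ⁻¹' {i})) ≠ ∞ :=
    ENNReal.sum_ne_top.2 fun i _ => ENNReal.sub_ne_top (measure_ne_top _ _)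
  rw [Measure.map_apply measurable_fst hS, ← Set.prod_univ]
  simp only [partitionCoupling, Measure.add_apply, Measure.coe_finsetSum, Finset.sum_apply,
    Measure.smul_apply, smul_eq_mul, Measure.prod_prod]
  have h1 : ∀ i, min (μ (ℓ ⁻¹' {i})) (ν (ℓ' ⁻¹' {i})) *
      (cond μ (ℓ ⁻¹' {i}) S * cond ν (ℓ' ⁻¹' {i}) Set.univ) =
      min (μ (ℓ ⁻¹' {i})) (ν (ℓ' ⁻¹' {i})) * cond μ (ℓ ⁻¹' {i}) S := fun i => by
    rw [mul_left_comm, mul_cond_univ_of_le ν _ (min_le_right _ _), mul_comm]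
  have h2 : ∀ i, (ν (ℓ' ⁻¹' {i}) - μ (ℓ ⁻¹' {i})) * cond ν (ℓ' ⁻¹' {i}) Set.univ =
      ν (ℓ' ⁻¹' {i}) - μ (ℓ ⁻¹' {i}) := fun i => mul_cond_univ_of_le ν _ tsub_le_self
  simp_rw [h1, h2, ← hr]
  have h3 : (∑ i, (μ (ℓ ⁻¹' {i}) - ν (ℓ' ⁻¹' {i})))⁻¹ *
      ((∑ i, (μ (ℓ ⁻¹' {i}) - ν (ℓ' ⁻¹' {i})) * cond μ (ℓ ⁻¹' {i}) S) *
        ∑ i, (μ (ℓ ⁻¹' {i}) - ν (ℓ' ⁻¹' {i}))) =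
      ∑ i, (μ (ℓ ⁻¹' {i}) - ν (ℓ' ⁻¹' {i})) * cond μ (ℓ ⁻¹' {i}) S := by
    -- With zero total excess the inverse is `∞`, but every residual weight vanishes, so the product
    -- is still `0`.
    by_cases h0 : ∑ i, (μ (ℓ ⁻¹' {i}) - ν (ℓ' ⁻¹' {i})) = 0
    · have h0' := Finset.sum_eq_zero_iff.1 h0
      rw [h0, mul_zero, mul_zero]
      exact (Finset.sum_eq_zero fun i hi => by rw [h0' i hi, zero_mul]).symm
    · rw [mul_left_comm, ENNReal.inv_mul_cancel h0 hfin, mul_one]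
  rw [h3, ← Finset.sum_add_distrib]
  simp_rw [← add_mul, ENNReal.min_add_tsub_right]
  exact sum_measure_smul_cond μ hℓ S hS

lemma partitionCoupling_map_snd
    (hℓ : ∀ i, MeasurableSet (ℓ ⁻¹' {i})) (hℓ' : ∀ i, MeasurableSet (ℓ' ⁻¹' {i})) :
    (partitionCoupling μ ν (fun i => ℓ ⁻¹' {i}) (fun i => ℓ' ⁻¹' {i})).map Prod.snd = ν := by
  have hr := ENNReal.sum_tsub_comm_of_sum_eq (fun i => μ (ℓ ⁻¹' {i})) (fun i => ν (ℓ' ⁻¹' {i}))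
    (by simp [sum_measure_fiber μ hℓ]) (by rw [sum_measure_fiber μ hℓ, sum_measure_fiber ν hℓ'])
  refine Eq.trans ?_ (partitionCoupling_map_fst ν μ hℓ' hℓ)
  ext S hS
  rw [Measure.map_apply measurable_fst hS, Measure.map_apply measurable_snd hS, ← Set.prod_univ,
    ← Set.univ_prod]
  simp only [partitionCoupling, Measure.add_apply, Measure.coe_finsetSum, Finset.sum_apply,
    Measure.smul_apply, smul_eq_mul, Measure.prod_prod, hr]
  congr 1
  · refine Finset.sum_congr rfl fun i _ => ?_
    rw [min_comm, mul_comm (cond μ _ _)]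
  · rw [mul_comm (∑ i, _ * cond μ _ _)]

/-- The diagonal part lives on pairs with equal labels. Only the residual product contributes, and
with total excess `r` its mass is `r⁻¹ * r * r ≤ r`, also for `r = 0`. -/
lemma partitionCoupling_ne_le
    (hℓ : ∀ i, MeasurableSet (ℓ ⁻¹' {i})) (hℓ' : ∀ i, MeasurableSet (ℓ' ⁻¹' {i})) :
    partitionCoupling μ ν (fun i => ℓ ⁻¹' {i}) (fun i => ℓ' ⁻¹' {i}) {z | ℓ z.1 ≠ ℓ' z.2} ≤
      ∑ i, (μ (ℓ ⁻¹' {i}) - ν (ℓ' ⁻¹' {i})) := by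
  have hr := ENNReal.sum_tsub_comm_of_sum_eq (fun i => μ (ℓ ⁻¹' {i})) (fun i => ν (ℓ' ⁻¹' {i}))
    (by simp [sum_measure_fiber μ hℓ]) (by rw [sum_measure_fiber μ hℓ, sum_measure_fiber ν hℓ'])
  simp only [partitionCoupling, Measure.add_apply, Measure.coe_finsetSum, Finset.sum_apply,
    Measure.smul_apply, smul_eq_mul]
  have h1 : ∀ i, (cond μ (ℓ ⁻¹' {i})).prod (cond ν (ℓ' ⁻¹' {i})) {z | ℓ z.1 ≠ ℓ' z.2} = 0 := by
    intro i
    refine measure_mono_null (t := (ℓ ⁻¹' {i})ᶜ ×ˢ Set.univ ∪ Set.univ ×ˢ (ℓ' ⁻¹' {i})ᶜ) ?_ ?_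
    · intro z hz
      by_contra hc
      simp only [Set.mem_union, Set.mem_prod, Set.mem_compl_iff, Set.mem_preimage,
        Set.mem_singleton_iff, Set.mem_univ, and_true, true_and, not_or, not_not] at hc
      exact hz (hc.1.trans hc.2.symm)
    · refine measure_union_null ?_ ?_
      · rw [Measure.prod_prod, cond_apply (hℓ i)]; simp
      · rw [Measure.prod_prod, cond_apply (hℓ' i)]; simp
  simp only [h1, mul_zero, Finset.sum_const_zero, zero_add]
  refine (mul_le_mul_right (measure_mono (Set.subset_univ _)) _).trans ?_
  rw [← Set.univ_prod_univ, Measure.prod_prod]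
  simp only [Measure.coe_finsetSum, Finset.sum_apply, Measure.smul_apply, smul_eq_mul,
    mul_cond_univ_of_le μ _ (tsub_le_self), mul_cond_univ_of_le ν _ (tsub_le_self), ← hr]
  rw [← mul_assoc]
  exact mul_le_of_le_one_left' (ENNReal.inv_mul_le_one _)

/-- Two probability measures with finite labellings have a coupling under which the labels differ
with probability at most the total excess of the label masses. -/
theorem exists_coupling_label_ne_le
    (hℓ : ∀ i, MeasurableSet (ℓ ⁻¹' {i})) (hℓ' : ∀ i, MeasurableSet (ℓ' ⁻¹' {i})) :
    ∃ π : Measure (α × β), IsProbabilityMeasure π ∧ π.map Prod.fst = μ ∧ π.map Prod.snd = ν ∧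
      π {z | ℓ z.1 ≠ ℓ' z.2} ≤ ∑ i, (μ (ℓ ⁻¹' {i}) - ν (ℓ' ⁻¹' {i})) := by
  refine ⟨_, ?_, partitionCoupling_map_fst μ ν hℓ hℓ', partitionCoupling_map_snd μ ν hℓ hℓ',
    partitionCoupling_ne_le μ ν hℓ hℓ'⟩
  constructor
  have h := congrArg (· Set.univ) (partitionCoupling_map_fst μ ν hℓ hℓ')
  simpa [Measure.map_apply measurable_fst MeasurableSet.univ] using h

end Coupling

/-! ### Frequencies and distinctness of i.i.d. samples. -/

section Sampling

open ProbabilityTheory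

variable {α : Type*} [MeasurableSpace α]

/-- Quantitative weak law of large numbers for the frequency of an event. -/
lemma pi_frequency_deviation_le (μ : Measure α) [IsProbabilityMeasure μ] {A : Set α}
    (hA : MeasurableSet A) {c : ℝ} (hc : 0 < c) {n : ℕ} (hn : 0 < n) :
    (Measure.pi fun _ : Fin n => μ).real
      {x | c ≤ |(∑ j, A.indicator (fun _ => (1 : ℝ)) (x j)) / n - μ.real A|} ≤ 1 / (n * c ^ 2) := by
  have hn' : (0 : ℝ) < n := by exact_mod_cast hn
  set g : α → ℝ := A.indicator fun _ => (1 : ℝ) with hg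
  have hgm : Measurable g := measurable_const.indicator hA
  have hgb : ∀ a, g a ∈ Set.Icc (0 : ℝ) 1 := fun a => by
    by_cases h : a ∈ A <;> simp [hg, h]
  have hgL : MemLp g 2 μ := memLp_of_bounded (ae_of_all _ hgb) hgm.aestronglyMeasurable 2
  set S : (Fin n → α) → ℝ := ∑ j, fun x => g (x j) with hS
  have hgj : ∀ j : Fin n, MemLp (fun x : Fin n → α => g (x j)) 2 (Measure.pi fun _ : Fin n => μ) :=
    fun j => hgL.comp_measurePreserving (measurePreserving_eval (fun _ : Fin n => μ) j)
  have hSL : MemLp S 2 (Measure.pi fun _ : Fin n => μ) := memLp_finsetSum' _ fun j _ => hgj j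
  have hint : ∫ x, S x ∂(Measure.pi fun _ : Fin n => μ) = n * μ.real A := by
    simp only [hS, Finset.sum_apply]
    rw [integral_finsetSum _ fun j _ => (hgj j).integrable (by norm_num)]
    have : ∀ j : Fin n, ∫ x, g (x j) ∂(Measure.pi fun _ : Fin n => μ) = μ.real A := fun j => by
      rw [integral_comp_eval (μ := fun _ : Fin n => μ) (i := j) (f := g) hgm.aestronglyMeasurable,
        hg, integral_indicator_const _ hA]
      simp
    simp [this]
  -- A variable with values in `[0, 1]` has variance at most `1/4`; the cruder bound `n` for the sum
  -- is enough.
  have hvar : variance S (Measure.pi fun _ : Fin n => μ) ≤ n := by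
    rw [hS, variance_sum_pi fun _ => hgL]
    have := variance_le_sq_of_bounded (ae_of_all μ hgb) hgm.aemeasurable
    simp only [Finset.sum_const, Finset.card_univ, Fintype.card_fin, nsmul_eq_mul]
    nlinarith
  have hch := meas_ge_le_variance_div_sq hSL (c := n * c) (by positivity)
  rw [hint] at hch
  have hset : {x : Fin n → α | c ≤ |(∑ j, g (x j)) / n - μ.real A|} =
      {x | n * c ≤ |S x - n * μ.real A|} := by
    ext x
    have : S x - n * μ.real A = n * ((∑ j, g (x j)) / n - μ.real A) := by
      simp only [hS, Finset.sum_apply]; field_simp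
    simp only [Set.mem_ofPred_eq]
    rw [this, abs_mul, abs_of_pos hn', mul_le_mul_iff_right₀ hn']
  rw [hset]
  refine (ENNReal.toReal_mono ENNReal.ofReal_ne_top hch).trans ?_
  rw [ENNReal.toReal_ofReal (div_nonneg (variance_nonneg _ _) (by positivity)),
    div_le_div_iff₀ (by positivity) (by positivity)]
  have : (0:ℝ) ≤ n * c ^ 2 := by positivity
  nlinarith [mul_le_mul_of_nonneg_right hvar this]

/-- The points of an i.i.d. sample of a non-atomic measure are almost surely distinct. -/
lemma ae_pi_injective [MeasurableEq α] (μ : Measure α) [IsProbabilityMeasure μ]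
    [NullSingletonClass μ] (n : ℕ) :
    ∀ᵐ x ∂(Measure.pi fun _ : Fin n => μ), Function.Injective x := by
  have h : ∀ i j : Fin n, i ≠ j → ∀ᵐ x ∂(Measure.pi fun _ : Fin n => μ), x i ≠ x j := by
    intro i j hij
    have hind := (iIndepFun_pi (μ := fun _ : Fin n => μ) (X := fun _ => id)
      fun _ => aemeasurable_id).indepFun hij
    have hmap := hind.map_prod_eq_prod_map_map (measurable_pi_apply i).aemeasurable
      (measurable_pi_apply j).aemeasurable
    change Measure.map (fun x : Fin n → α => (x i, x j)) _ =
      (Measure.map (Function.eval i) (Measure.pi fun _ : Fin n => μ)).prod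
        (Measure.map (Function.eval j) (Measure.pi fun _ : Fin n => μ)) at hmap
    rw [(measurePreserving_eval (fun _ : Fin n => μ) i).map_eq,
      (measurePreserving_eval (fun _ : Fin n => μ) j).map_eq] at hmap
    -- Fubini: every slice of the diagonal is a singleton, hence null.
    have hd : (μ.prod μ) (Set.diagonal α) = 0 := by
      rw [Measure.measure_prod_null measurableSet_diagonal]
      refine ae_of_all _ fun a => ?_
      have : Prod.mk a ⁻¹' Set.diagonal α = {a} := by
        ext b; simp [eq_comm]
      simp [this]
    rw [← hmap, Measure.map_apply (by fun_prop) measurableSet_diagonal] at hd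
    rw [ae_iff]
    convert hd using 2
    ext x; simp
  have h' : ∀ᵐ x ∂(Measure.pi fun _ : Fin n => μ), ∀ i j : Fin n, i ≠ j → x i ≠ x j := by
    simp_rw [ae_all_iff]; exact h
  filter_upwards [h'] with x hx i j hij
  by_contra hne
  exact hx i j hne hij

end Sampling

/-! ### Non-atomic spaces do not concentrate; bounds on Gromov's distance. -/

namespace MMSpace

/-- The measure of the sample space of distinct points is the empirical frequency. -/
lemma sample_real_preimage (Ω : MMSpace.{u}) {n : ℕ} [NeZero n] {x : Fin n → Ω}
    (hx : Function.Injective x) (A : Set Ω) :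
    (Ω.sample x).μ.real ((Subtype.val : Set.range x → Ω) ⁻¹' A) =
      (∑ j, A.indicator (fun _ => (1 : ℝ)) (x j)) / n := by
  classical
  change (ProbabilityTheory.uniformOn (Set.univ : Set (Set.range x))
    ((Subtype.val : Set.range x → Ω) ⁻¹' A)).toReal = _
  let e : Fin n ≃ Set.range x := Equiv.ofInjective x hx
  have hcard : Fintype.card (Set.range x) = n := by rw [← Fintype.card_congr e, Fintype.card_fin]
  have hcount : Measure.count ((Subtype.val : Set.range x → Ω) ⁻¹' A) =
      ((Finset.univ.filter fun j => x j ∈ A).card : ℝ≥0∞) := by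
    have : (Subtype.val : Set.range x → Ω) ⁻¹' A =
        ((Finset.univ.filter fun j => x j ∈ A).map e.toEmbedding : Finset (Set.range x)) := by
      ext ⟨_, j, rfl⟩
      have hj : e j = ⟨x j, j, rfl⟩ := rfl
      simp [← hj]
      simp [hj]
    rw [this, Measure.count_apply_finset, Finset.card_map]
  rw [ProbabilityTheory.uniformOn_univ, hcard, hcount]
  simp [Set.indicator_apply]

/-- A non-atomic mm-space, taken as a constant sequence, is not a Lévy family. -/
lemma not_isLevy_const (Ω : MMSpace.{u}) [NullSingletonClass Ω.μ] :
    ¬ IsLevy (fun _ => Ω) := by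
  intro h
  have hzero : ∀ ε : ℝ, 0 < ε → Ω.concFun ε = 0 := fun ε hε =>
    tendsto_nhds_unique tendsto_const_nhds (h ε hε)
  -- A closed set is the intersection of its thickenings, and all of these have full measure because
  -- the concentration function vanishes.
  have hfull : ∀ A : Set Ω, IsClosed A → 1 / 2 ≤ Ω.μ.real A → Ω.μ Aᶜ = 0 := by
    intro A hA hA2
    have hth : ∀ ε : ℝ, 0 < ε → Ω.μ (Metric.thickening ε A)ᶜ = 0 := by
      intro ε hε
      rw [prob_compl_eq_zero_iff Metric.isOpen_thickening.measurableSet]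
      have h0 := hzero ε hε
      rw [concFun, if_neg hε.ne', sub_eq_zero] at h0
      have hle : (1 : ℝ) ≤ Ω.μ.real (Metric.thickening ε A) := h0.trans_le
        (csInf_le ⟨0, by rintro r ⟨B, -, -, rfl⟩; exact measureReal_nonneg⟩
          ⟨A, hA.measurableSet, hA2, rfl⟩)
      have h1 : Ω.μ.real (Metric.thickening ε A) = 1 := le_antisymm measureReal_le_one hle
      rw [measureReal_def, ENNReal.toReal_eq_one_iff] at h1
      exact h1
    have hcover : Aᶜ ⊆ ⋃ k : ℕ, (Metric.thickening (1 / ((k : ℝ) + 1)) A)ᶜ := by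
      intro y hy
      by_contra hc
      simp only [Set.mem_iUnion, Set.mem_compl_iff, not_exists, not_not] at hc
      refine hy (hA.closure_eq ▸ Metric.mem_closure_iff.2 fun ε hε => ?_)
      obtain ⟨k, hk⟩ := exists_nat_one_div_lt hε
      obtain ⟨z, hz, hyz⟩ := Metric.mem_thickening_iff.1 (hc k)
      exact ⟨z, hz, hyz.trans hk⟩
    exact measure_mono_null hcover (measure_iUnion_null fun k => hth _ (by positivity))
  -- Points are null, so small balls have measure below `1/2`; the closed complement then has full
  -- measure by `hfull`.
  have hloc : ∀ y : Ω, ∃ r : ℝ, 0 < r ∧ Ω.μ (Metric.ball y r) = 0 := by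
    intro y
    have ht : Tendsto (fun k : ℕ => Ω.μ (Metric.ball y (1 / ((k : ℝ) + 1)))) atTop
        (𝓝 (Ω.μ (⋂ k : ℕ, Metric.ball y (1 / ((k : ℝ) + 1))))) := by
      refine tendsto_measure_iInter_atTop
        (fun k => Metric.isOpen_ball.measurableSet.nullMeasurableSet) ?_ ⟨0, measure_ne_top _ _⟩
      intro a b hab
      exact Metric.ball_subset_ball (by gcongr)
    have hI : (⋂ k : ℕ, Metric.ball y (1 / ((k : ℝ) + 1))) ⊆ {y} := by
      intro z hz
      by_contra hne
      obtain ⟨k, hk⟩ := exists_nat_one_div_lt (dist_pos.2 hne)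
      exact absurd (Metric.mem_ball.1 (Set.mem_iInter.1 hz k)) (not_lt.2 hk.le)
    rw [measure_mono_null hI (measure_singleton y)] at ht
    obtain ⟨k, hk⟩ := (ht.eventually (gt_mem_nhds (show (0 : ℝ≥0∞) < ENNReal.ofReal (1 / 2) by
      simp))).exists
    refine ⟨1 / ((k : ℝ) + 1), by positivity, ?_⟩
    have hb : Ω.μ.real (Metric.ball y (1 / ((k : ℝ) + 1))) < 1 / 2 :=
      (ENNReal.lt_ofReal_iff_toReal_lt (measure_ne_top _ _)).1 hk
    have := hfull (Metric.ball y (1 / ((k : ℝ) + 1)))ᶜ Metric.isOpen_ball.isClosed_compl (by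
      rw [probReal_compl_eq_one_sub Metric.isOpen_ball.measurableSet]; linarith)
    rwa [compl_compl] at this
  have := UniformSpace.secondCountable_of_separable Ω
  have hnull : Ω.μ Set.univ = 0 := measure_null_of_locally_null _ fun y _ => by
    obtain ⟨r, hr, h0⟩ := hloc y
    exact ⟨_, mem_nhdsWithin_of_mem_nhds (Metric.ball_mem_nhds y hr), h0⟩
  simp at hnull

lemma dconc_nonneg (X : MMSpace.{u}) (Y : MMSpace.{v}) : 0 ≤ dconc X Y :=
  Real.sInf_nonneg fun _ h => h.1.le

lemma dconc_le (X : MMSpace.{u}) (Y : MMSpace.{v}) {ε : ℝ} (hε : 0 < ε)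
    {φ : unitInterval → X} {ψ : unitInterval → Y} (hφ : X.IsParam φ) (hψ : Y.IsParam ψ)
    (h₁ : ∀ f : X → ℝ, LipschitzWith 1 f →
      ∃ g : Y → ℝ, LipschitzWith 1 g ∧ me1 (f ∘ φ) (g ∘ ψ) < ε)
    (h₂ : ∀ g : Y → ℝ, LipschitzWith 1 g →
      ∃ f : X → ℝ, LipschitzWith 1 f ∧ me1 (f ∘ φ) (g ∘ ψ) < ε) : dconc X Y ≤ ε :=
  csInf_le ⟨0, fun _ h => h.1.le⟩ ⟨hε, φ, ψ, hφ, hψ, h₁, h₂⟩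

lemma me1_le {f g : unitInterval → ℝ} {ε : ℝ} (hε : 0 < ε)
    (h : (volume : Measure unitInterval).real {t | ε < |f t - g t|} < ε) : me1 f g ≤ ε :=
  csInf_le ⟨0, fun _ h => h.1.le⟩ ⟨hε, h⟩

/-- A coupling of a sample space with `Ω` concentrated near the diagonal bounds the distance. -/
lemma dconc_sample_le_of_coupling (Ω : MMSpace.{u}) {n : ℕ} [NeZero n] (x : Fin n → Ω)
    (π : Measure (Set.range x × Ω)) [IsProbabilityMeasure π]
    (h₁ : π.map Prod.fst = (Ω.sample x).μ) (h₂ : π.map Prod.snd = Ω.μ) {η ε : ℝ} (hη : 0 < η)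
    (hηε : η < ε) (h : π {z | η < dist (z.1 : Ω) z.2} < ENNReal.ofReal η) :
    dconc (Ω.sample x) Ω ≤ ε := by
  have : Nonempty (Set.range x × Ω) := nonempty_of_isProbabilityMeasure π
  classical
  -- The coupling is an image of Lebesgue measure under `F`; the coordinates of `F` serve as the two
  -- parametrizations.
  obtain ⟨F, hF, hFπ⟩ := π.exists_measurable_map_eq
  have := UniformSpace.secondCountable_of_separable Ω
  have hm : MeasurableSet {z : Set.range x × Ω | η < dist (z.1 : Ω) z.2} :=
    measurableSet_lt measurable_const
      ((measurable_subtype_coe.comp measurable_fst).dist measurable_snd)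
  have hF' : (volume : Measure unitInterval) {t | η < dist ((F t).1 : Ω) (F t).2} <
      ENNReal.ofReal η := by
    rw [← hFπ, Measure.map_apply hF hm] at h
    exact h
  have hme : ∀ g : Ω → ℝ, LipschitzWith 1 g → ∀ f : Set.range x → ℝ, (∀ y, f y = g y) →
      me1 (f ∘ fun t => (F t).1) (g ∘ fun t => (F t).2) < ε := by
    intro g hg f hfg
    refine (me1_le hη ?_).trans_lt hηε
    refine (ENNReal.lt_ofReal_iff_toReal_lt (measure_ne_top _ _)).1
      ((measure_mono fun t ht => ?_).trans_lt hF')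
    refine lt_of_lt_of_le (Set.mem_ofPred.1 ht) ?_
    have := hg.dist_le_mul ((F t).1 : Ω) (F t).2
    simpa [Real.dist_eq, hfg] using this
  refine dconc_le (Ω.sample x) Ω (hη.trans hηε) (φ := fun t => (F t).1) (ψ := fun t => (F t).2)
    ⟨measurable_fst.comp hF, ?_⟩ ⟨measurable_snd.comp hF, ?_⟩ ?_ ?_
  · rw [← h₁, ← hFπ, Measure.map_map measurable_fst hF]; rfl
  · rw [← h₂, ← hFπ, Measure.map_map measurable_snd hF]; rfl
  · intro f hf
    obtain ⟨g, hg, hfg⟩ := LipschitzOnWith.extend_real (s := Set.range x) (K := 1)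
      (f := fun y => if hy : y ∈ Set.range x then f ⟨y, hy⟩ else 0) (by
        rw [lipschitzOnWith_iff_restrict]
        have heq : (Set.range x).domRestrict
            (fun y => if hy : y ∈ Set.range x then f ⟨y, hy⟩ else 0) = fun y : Set.range x => f y := funext fun y => dif_pos y.2
        rw [heq]
        exact hf)
    refine ⟨g, hg, hme g hg f fun y => ?_⟩
    have := hfg y.2
    simp only at this
    rw [dif_pos y.2] at this
    exact this
  · intro g hg
    exact ⟨fun y => g y.1, by simpa using! hg.comp (LipschitzWith.subtype_val (Set.range x)),
      hme g hg _ fun _ => rfl⟩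

end MMSpace

/-! ### Finite partitions and convergence of samples. -/

namespace MMSpace

/-- An mm-space splits into finitely many measurable pieces which are small, except for one
of small measure. -/
lemma exists_finite_label (Ω : MMSpace.{u}) {r : ℝ} (hr : 0 < r) :
    ∃ (k : ℕ) (ℓ : Ω → Fin (k + 1)), Measurable ℓ ∧
      Ω.μ (ℓ ⁻¹' {Fin.last k}) < ENNReal.ofReal r ∧
      ∀ x y, ℓ x = ℓ y → ℓ y ≠ Fin.last k → dist x y ≤ 2 * r := by
  classical
  have := nonempty_of_isProbabilityMeasure Ω.μ
  have hex : ∀ x : Ω, ∃ i, dist x (TopologicalSpace.denseSeq Ω i) < r := fun x => by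
    obtain ⟨_, ⟨i, rfl⟩, hi⟩ :=
      Metric.mem_closure_iff.1 (TopologicalSpace.denseRange_denseSeq Ω x) r hr
    exact ⟨i, hi⟩
  -- Index of the first dense point within `r`. Indices from some `k` on have small total mass and
  -- are merged into the last label.
  let N : Ω → ℕ := fun x => Nat.find (hex x)
  have hN : Measurable N := measurable_find hex fun i =>
    (measurableSet_lt (continuous_id.dist continuous_const).measurable measurable_const)
  have ht : Tendsto (fun k : ℕ => Ω.μ (N ⁻¹' Set.Ici k)) atTop
      (𝓝 (Ω.μ (⋂ k : ℕ, N ⁻¹' Set.Ici k))) := by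
    refine tendsto_measure_iInter_atTop (fun k => (hN measurableSet_Ici).nullMeasurableSet) ?_
      ⟨0, measure_ne_top _ _⟩
    intro a b hab x hx
    exact le_trans hab hx
  have hI : (⋂ k : ℕ, N ⁻¹' Set.Ici k) = ∅ := by
    refine Set.eq_empty_of_forall_notMem fun x hx => ?_
    have h : N x + 1 ≤ N x := Set.mem_iInter.1 hx (N x + 1)
    omega
  rw [hI, measure_empty] at ht
  obtain ⟨k, hk⟩ := (ht.eventually (gt_mem_nhds (ENNReal.ofReal_pos.2 hr))).exists
  refine ⟨k, fun x => Fin.ofNat (k + 1) (min (N x) k),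
    -- `Fin.ofNat` reduces modulo `k + 1`, which is harmless after truncation at `k`.
    (measurable_of_countable (fun m : ℕ => Fin.ofNat (k + 1) (min m k))).comp hN, ?_, ?_⟩
  · refine (measure_mono fun x hx => ?_).trans_lt hk
    have h := congrArg Fin.val (Set.mem_singleton_iff.1 hx)
    simp only [Fin.val_ofNat, Fin.val_last] at h
    rw [Nat.mod_eq_of_lt (by omega)] at h
    exact (show k ≤ N x by omega)
  · intro x y hxy hy
    have hxy := congrArg Fin.val hxy
    have hy : ¬ (Fin.ofNat (k + 1) (min (N y) k)).val = (Fin.last k).val := fun h => hy (Fin.ext h)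
    simp only [Fin.val_ofNat, Fin.val_last] at hxy hy
    rw [Nat.mod_eq_of_lt (by omega)] at hxy hy
    rw [Nat.mod_eq_of_lt (by omega)] at hxy
    have hNxy : N x = N y := by omega
    have h1 : dist x (TopologicalSpace.denseSeq Ω (N x)) < r := Nat.find_spec (hex x)
    have h2 : dist y (TopologicalSpace.denseSeq Ω (N y)) < r := Nat.find_spec (hex y)
    rw [hNxy] at h1
    linarith [dist_triangle_right x y (TopologicalSpace.denseSeq Ω (N y))]

/-- Random samples of a non-atomic mm-space converge to it in probability for Gromov's distance. -/
theorem exists_dconc_sample_le (Ω : MMSpace.{u}) [NullSingletonClass Ω.μ] {η δ : ℝ} (hη : 0 < η)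
    (hδ : 0 < δ) :
    ∃ n₀ : ℕ, ∀ (n : ℕ) [NeZero n], n₀ ≤ n →
      ∃ E : Set (Fin n → Ω), MeasurableSet E ∧
        1 - δ < (Measure.pi fun _ : Fin n => Ω.μ).real E ∧
        ∀ x ∈ E, dconc (Ω.sample x) Ω ≤ η := by
  -- With `r = η / 4`, good cells have diameter at most `η / 2` and the bad one has mass below `η /
  -- 4`.
  obtain ⟨k, ℓ, hℓ, hlast, hdist⟩ := Ω.exists_finite_label (r := η / 4) (by positivity)
  have := UniformSpace.secondCountable_of_separable Ω
  -- The `k + 1` frequency errors, each below `c`, add up to at most `η / 4`.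
  set c : ℝ := η / 4 / (k + 1) with hc
  have hc0 : 0 < c := by positivity
  -- Makes the union bound `(k + 1) / (n * c ^ 2)` smaller than `δ`.
  obtain ⟨n₀, hn₀⟩ := exists_nat_gt ((k + 1) / (c ^ 2 * δ))
  refine ⟨n₀, fun n _ hn => ?_⟩
  have hn0 : 0 < n := Nat.pos_of_ne_zero (NeZero.ne n)
  set P := Measure.pi fun _ : Fin n => Ω.μ with hP
  let A : Fin (k + 1) → Set Ω := fun i => ℓ ⁻¹' {i}
  have hA : ∀ i, MeasurableSet (A i) := fun i => hℓ (measurableSet_singleton i)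
  let D : Fin (k + 1) → Set (Fin n → Ω) := fun i =>
    {x | c ≤ |(∑ j, (A i).indicator (fun _ => (1 : ℝ)) (x j)) / n - Ω.μ.real (A i)|}
  let B : Set (Fin n → Ω) := {x | Function.Injective x}ᶜ ∪ ⋃ i, D i
  have hB : P.real B < δ := by
    have h0 : P.real ({x | Function.Injective x}ᶜ) = 0 := by
      rw [measureReal_def]
      have := ae_iff.1 (ae_pi_injective Ω.μ n)
      exact (congrArg ENNReal.toReal this).trans ENNReal.toReal_zero
    have h1 : P.real (⋃ i, D i) ≤ ∑ _i : Fin (k + 1), 1 / (n * c ^ 2) :=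
      (measureReal_iUnion_fintype_le D).trans
        (Finset.sum_le_sum fun i _ => pi_frequency_deviation_le Ω.μ (hA i) hc0 hn0)
    have h2 : ∑ _i : Fin (k + 1), 1 / (n * c ^ 2) < δ := by
      have hn' : ((k : ℝ) + 1) / (c ^ 2 * δ) < n := hn₀.trans_le (by exact_mod_cast hn)
      rw [div_lt_iff₀ (by positivity)] at hn'
      simp only [Finset.sum_const, Finset.card_univ, Fintype.card_fin, nsmul_eq_mul,
        mul_one_div]
      rw [div_lt_iff₀ (by positivity)]
      push_cast
      linarith
    calc P.real B ≤ _ := measureReal_union_le _ _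
      _ < δ := by rw [h0]; linarith
  -- The measurable hull has the same mass as `B`, so measurability of `B` is not needed.
  refine ⟨(toMeasurable P B)ᶜ, (measurableSet_toMeasurable P B).compl, ?_, fun x hx => ?_⟩
  · rw [probReal_compl_eq_one_sub (measurableSet_toMeasurable P B), measureReal_def,
      measure_toMeasurable, ← measureReal_def]
    linarith
  · have hxB : x ∉ B := fun h => hx (subset_toMeasurable P B h)
    have hinj : Function.Injective x := by
      by_contra h
      exact hxB (Or.inl h)
    have hfreq : ∀ i, |(∑ j, (A i).indicator (fun _ => (1 : ℝ)) (x j)) / n - Ω.μ.real (A i)| < c :=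
      fun i => by
        by_contra h
        exact hxB (Or.inr (Set.mem_iUnion.2 ⟨i, not_lt.1 h⟩))
    let ν : Measure (Set.range x) := (Ω.sample x).μ
    have : IsProbabilityMeasure ν := (Ω.sample x).prob
    let ℓ' : Set.range x → Fin (k + 1) := fun y => ℓ y
    obtain ⟨π, hπ, hfst, hsnd, hne⟩ := exists_coupling_label_ne_le ν Ω.μ (ℓ := ℓ') (ℓ' := ℓ)
      (fun i => measurable_subtype_coe (hA i)) hA
    refine Ω.dconc_sample_le_of_coupling x π hfst hsnd (η := η / 2) (by positivity)
      (by linarith) ?_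
    -- Points more than `η / 2` apart either have different labels or share the bad one; each event
    -- costs at most `η / 4`.
    have hsub : {z : Set.range x × Ω | η / 2 < dist (z.1 : Ω) z.2} ⊆
        {z | ℓ' z.1 ≠ ℓ z.2} ∪ Prod.snd ⁻¹' (ℓ ⁻¹' {Fin.last k}) := by
      intro z hz
      by_contra hcon
      simp only [Set.mem_union, not_or] at hcon
      have h1 : ℓ' z.1 = ℓ z.2 := not_not.1 hcon.1
      have h2 := hdist z.1 z.2 h1 hcon.2
      have h3 : η / 2 < dist (z.1 : Ω) z.2 := hz
      linarith
    have hexc : ∑ i, (ν (ℓ' ⁻¹' {i}) - Ω.μ (ℓ ⁻¹' {i})) ≤ ENNReal.ofReal (η / 4) := by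
      have hi : ∀ i, ν (ℓ' ⁻¹' {i}) - Ω.μ (ℓ ⁻¹' {i}) ≤ ENNReal.ofReal c := fun i => by
        have h1 : ν.real (ℓ' ⁻¹' {i}) =
            (∑ j, (A i).indicator (fun _ => (1 : ℝ)) (x j)) / n :=
          Ω.sample_real_preimage hinj (A i)
        have h2 := (abs_lt.1 (hfreq i)).2
        rw [← h1] at h2
        rw [tsub_le_iff_right, ← ENNReal.ofReal_toReal (measure_ne_top ν (ℓ' ⁻¹' {i})),
          ← ENNReal.ofReal_toReal (measure_ne_top Ω.μ (ℓ ⁻¹' {i})),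
          ← ENNReal.ofReal_add hc0.le ENNReal.toReal_nonneg]
        refine ENNReal.ofReal_le_ofReal ?_
        simp only [measureReal_def] at h2
        linarith
      refine (Finset.sum_le_sum fun i _ => hi i).trans (le_of_eq ?_)
      simp only [Finset.sum_const, Finset.card_univ, Fintype.card_fin, nsmul_eq_mul]
      rw [← ENNReal.ofReal_natCast, ← ENNReal.ofReal_mul (by positivity)]
      congr 1
      rw [hc]; push_cast; field_simp
    calc π {z : Set.range x × Ω | η / 2 < dist (z.1 : Ω) z.2}
        ≤ π {z | ℓ' z.1 ≠ ℓ z.2} + π (Prod.snd ⁻¹' (ℓ ⁻¹' {Fin.last k})) :=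
          (measure_mono hsub).trans (measure_union_le _ _)
      _ = π {z | ℓ' z.1 ≠ ℓ z.2} + Ω.μ (ℓ ⁻¹' {Fin.last k}) := by
          rw [← Measure.map_apply measurable_snd (hA _), hsnd]
      _ < ENNReal.ofReal (η / 4) + ENNReal.ofReal (η / 4) :=
          ENNReal.add_lt_add_of_le_of_lt
            (ne_top_of_le_ne_top ENNReal.ofReal_ne_top (hne.trans hexc)) (hne.trans hexc) hlast
      _ = ENNReal.ofReal (η / 2) := by
          rw [← ENNReal.ofReal_add (by positivity) (by positivity)]; congr 1; ring

/-- An intrinsic dimension function is continuous for Gromov's distance at spaces of finite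
dimension. -/
lemma IsIntrinsicDim.exists_dconc_le_imp {𝓜 : Set MMSpace.{u}} {dim : 𝓜 → ℝ≥0∞}
    (hdim : IsIntrinsicDim 𝓜 dim) {Y : 𝓜} (hY : dim Y ≠ ∞) {ε : ℝ} (hε : 0 < ε) :
    ∃ η : ℝ, 0 < η ∧ ∀ X : 𝓜, dconc X.1 Y.1 ≤ η →
      dim X ≠ ∞ ∧ |(dim Y).toReal - (dim X).toReal| < ε := by
  -- Counterexamples for `η = 1 / (k + 1)` would form a sequence converging to `Y`. Finiteness of
  -- the limit makes their dimensions eventually finite and lets `toReal` pass to the limit.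
  by_contra! hcon
  choose X hX hbad using fun k : ℕ => hcon (1 / ((k : ℝ) + 1)) (by positivity)
  have ht := hdim.smooth X Y (squeeze_zero (fun k => dconc_nonneg _ _) hX
    tendsto_one_div_add_atTop_nhds_zero_nat)
  have htop : ∀ᶠ k in atTop, dim (X k) ≠ ∞ :=
    (ht.eventually (gt_mem_nhds hY.lt_top)).mono fun _ h => h.ne
  have hreal := (ENNReal.tendsto_toReal hY).comp ht
  obtain ⟨k, hk, hk'⟩ := (htop.and (Metric.tendsto_nhds.1 hreal ε hε)).exists
  refine absurd (hbad k hk) (not_le.2 ?_)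
  rwa [Function.comp_apply, dist_comm, Real.dist_eq] at hk'

end MMSpace

theorem mainTheorem2 (𝓜 : Set MMSpace.{u}) (dim : 𝓜 → ℝ≥0∞)
    (hdim : MMSpace.IsIntrinsicDim 𝓜 dim)
    (Ω : 𝓜) [NullSingletonClass Ω.1.μ] :
    dim Ω ≠ ∞ ∧
      ∀ ε δ : ℝ, 0 < ε → 0 < δ → ∃ n₀ : ℕ, ∀ (n : ℕ) [NeZero n], n₀ ≤ n →
        ∃ E : Set (Fin n → Ω.1), MeasurableSet E ∧
          1 - δ < (Measure.pi fun _ : Fin n => Ω.1.μ).real E ∧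
          ∀ x ∈ E, ∀ hx : Ω.1.sample x ∈ 𝓜,
            dim ⟨Ω.1.sample x, hx⟩ ≠ ∞ ∧
              |(dim Ω).toReal - (dim ⟨Ω.1.sample x, hx⟩).toReal| < ε := by
  have hfin : dim Ω ≠ ∞ := fun h => Ω.1.not_isLevy_const
    ((hdim.concentration fun _ => Ω).2 (by rw [h]; exact tendsto_const_nhds))
  refine ⟨hfin, fun ε δ hε hδ => ?_⟩
  obtain ⟨η, hη, hcont⟩ := hdim.exists_dconc_le_imp hfin hε
  obtain ⟨n₀, hn₀⟩ := Ω.1.exists_dconc_sample_le hη hδ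
  refine ⟨n₀, fun n _ hn => ?_⟩
  obtain ⟨E, hE, hPE, h⟩ := hn₀ n hn
  exact ⟨E, hE, hPE, fun x hx hx' => hcont ⟨Ω.1.sample x, hx'⟩ (h x hx)⟩
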